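/- Let $\mathcal X$ be a Polish space with its Borel $\sigma$-algebra and let $(\mathcal P_t)_{t\ge 0}$ be a Markov semigroup on $\mathcal X$, that is, a family of Markov transition kernels $\mathcal P_t(x,A)$ with $\mathcal P_0(x,\cdot)=\delta_x$ and $\mathcal P_{s+t}(x,A)=\int_{\mathcal X}\mathcal P_t(y,A)\,\mathcal P_s(x,dy)$ for all $s,t\ge 0$. We use the following notions. (i) $\mathcal P_t$ is Feller if, for every $t\ge 0$ and every bounded continuous $\varphi:\mathcal X\to\mathbb R$, the function $x\mapsto\int\varphi(y)\,\mathcal P_t(x,dy)$ is continuous. (ii) $\mathcal P_t$ is weakly topologically irreducible if for all $u_1,u_2\in\mathcal X$ there is a $v\in\mathcal X$ such that for every open set $A$ containing $v$ there are $t_1,t_2>0$ with $\mathcal P_{t_1}(u_1,A)>0$ and $\mathcal P_{t_2}(u_2,A)>0$. (iii) A totally separating system of pseudo-metrics on $\mathcal X$ is a sequence $(d_n)$ of continuous pseudo-metrics $d_n:\mathcal X\times\mathcal X\to[0,\infty)$ which is pointwise non-decreasing in $n$ and satisfies $\lim_{n\to\infty}d_n(x,y)=1$ for all $x\ne y$.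 For Borel probability measures $\mu_1,\mu_2$ let $$\|\mu_1-\mu_2\|_{d_n}=\sup_\varphi\Big(\int\varphi\,d\mu_1-\int\varphi\,d\mu_2\Big),$$ the supremum over all $\varphi:\mathcal X\to\mathbb R$ with $|\varphi(x)-\varphi(y)|\le d_n(x,y)$ for all $x,y$, be the 1-Wasserstein distance induced by $d_n$ (such $\varphi$ are automatically bounded and continuous). $\mathcal P_t$ is asymptotically strong Feller if for every $x\in\mathcal X$ there exist a totally separating system of pseudo-metrics $(d_n)$ and a sequence of times $t_n>0$ such that $$\inf_{U\ni x\text{ open}}\ \limsup_{n\to\infty}\ \sup_{y\in U}\ \|\mathcal P_{t_n}(x,\cdot)-\mathcal P_{t_n}(y,\cdot)\|_{d_n}=0 .$$ If $\mathcal P_t$ is Feller, weakly topologically irreducible and asymptotically strong Feller, then it admits at most one invariant probability measure, i.e. at most one Borel probability measure $\mu$ with $\int\mathcal P_t(x,A)\,\mu(dx)=\mu(A)$ for all $t\ge 0$ and all Borel sets $A$. -/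

import Mathlib

open MeasureTheory ProbabilityTheory Filter Topology
open scoped NNReal ENNReal BoundedContinuousFunction

/-- A (time-homogeneous, continuous-time) Markov semigroup on `X`: Markov transition kernels
`P_t(x, A)`, `t ≥ 0`, with `P_0(x, ·) = δ_x` and the Chapman-Kolmogorov equations.
No regularity in the time variable is required. -/
structure MarkovSemigroup (X : Type*) [MeasurableSpace X] where
  /-- the transition kernels -/
  kernel : ℝ≥0 → Kernel X X
  isMarkovKernel : ∀ t, IsMarkovKernel (kernel t)
  kernel_zero : kernel 0 = Kernel.id
  kernel_add : ∀ s t, kernel (s + t) = kernel t ∘ₖ kernel s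

/-- `d` is a continuous pseudo-metric on `X`
(nonnegativity follows from the three algebraic axioms). -/
structure IsContinuousPseudoMetric {X : Type*} [TopologicalSpace X] (d : X → X → ℝ) : Prop where
  continuous : Continuous (fun p : X × X => d p.1 p.2)
  self : ∀ x, d x x = 0
  symm : ∀ x y, d x y = d y x
  triangle : ∀ x y z, d x z ≤ d x y + d y z

/-- A totally separating system of pseudo-metrics: an increasing sequence of continuous
pseudo-metrics `d_n` with `d_n(x, y) → 1` whenever `x ≠ y`. -/
structure IsTotallySeparating {X : Type*} [TopologicalSpace X] (d : ℕ → X → X → ℝ) : Prop where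
  isContinuousPseudoMetric : ∀ n, IsContinuousPseudoMetric (d n)
  monotone : ∀ x y, Monotone (fun n => d n x y)
  tendsto_one : ∀ x y, x ≠ y → Tendsto (fun n => d n x y) atTop (𝓝 1)

/-- The 1-Wasserstein distance between probability measures induced by a pseudo-metric `d`, in its
dual form: the supremum of `∫ φ dμ - ∫ φ dν` over the (bounded continuous) functions `φ` that have
Lipschitz constant one with respect to `d`. If `d` is continuous and bounded, as for every member
of a totally separating system, every `d`-Lipschitz function is bounded and continuous. -/
noncomputable def wassersteinOne {X : Type*} [TopologicalSpace X] [MeasurableSpace X]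
    (d : X → X → ℝ) (μ ν : Measure X) : ℝ≥0∞ :=
  ⨆ (φ : X →ᵇ ℝ) (_ : ∀ x y, |φ x - φ y| ≤ d x y),
    ENNReal.ofReal ((∫ x, φ x ∂μ) - ∫ x, φ x ∂ν)

namespace MarkovSemigroup

variable {X : Type*} [TopologicalSpace X] [MeasurableSpace X]

/-- The Feller property: `P_t φ` is continuous whenever `φ` is bounded and continuous. -/
def IsFeller (P : MarkovSemigroup X) : Prop :=
  ∀ (t : ℝ≥0) (φ : X →ᵇ ℝ), Continuous (fun x => ∫ y, φ y ∂(P.kernel t x))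

/-- Weak topological irreducibility: for all `u₁, u₂` there is a point `v` all of whose open
neighbourhoods are charged, at some positive times, by the transition probabilities from `u₁`
and from `u₂`. -/
def IsWeaklyTopologicallyIrreducible (P : MarkovSemigroup X) : Prop :=
  ∀ u₁ u₂ : X, ∃ v : X, ∀ A : Set X, IsOpen A → v ∈ A →
    ∃ t₁ t₂ : ℝ≥0, 0 < t₁ ∧ 0 < t₂ ∧ 0 < P.kernel t₁ u₁ A ∧ 0 < P.kernel t₂ u₂ A

/-- The asymptotic strong Feller property at the point `x`: for some totally separating system
`d_n` and some times `t_n > 0`, the infimum over the open neighbourhoods `U` of `x` of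
`limsup_n sup_{y ∈ U} d_n(P_{t_n}(x, ·), P_{t_n}(y, ·))` is zero. -/
def IsAsymptoticallyStrongFellerAt (P : MarkovSemigroup X) (x : X) : Prop :=
  ∃ (d : ℕ → X → X → ℝ) (t : ℕ → ℝ≥0), IsTotallySeparating d ∧ (∀ n, 0 < t n) ∧
    (⨅ (U : Set X) (_ : IsOpen U ∧ x ∈ U),
      limsup (fun n => ⨆ y ∈ U,
        wassersteinOne (d n) (P.kernel (t n) x) (P.kernel (t n) y)) atTop) = (0 : ℝ≥0∞)

/-- The asymptotic strong Feller property. -/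
def IsAsymptoticallyStrongFeller (P : MarkovSemigroup X) : Prop :=
  ∀ x, P.IsAsymptoticallyStrongFellerAt x

/-- `μ` is an invariant probability measure of the semigroup: `μ P_t = μ` for every `t ≥ 0`. -/
def IsInvariantProbability {X : Type*} [MeasurableSpace X]
    (P : MarkovSemigroup X) (μ : Measure X) : Prop :=
  IsProbabilityMeasure μ ∧ ∀ t, (P.kernel t).Invariant μ

end MarkovSemigroup

/-! If `μ ≠ ν` are invariant, the positive parts of `μ - ν` and `ν - μ` are invariant, and
normalising them gives mutually singular invariant probabilities (`exists_mutuallySingular_of_ne`).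
The Feller property and irreducibility give these a common support point `v` (`exists_mem_support`).
Singularity forces their `d n`-distance to tend to one (`eventually_exists_separating`). But near
`v` there is an open `U`, charged by both, on which `P_{t_n} φ` oscillates by at most 1/4 for all `d
n`-Lipschitz `φ` and large `n`. By invariance `φ` may be replaced by `P_{t_n} φ` under both
integrals, so the distance stays below one by a fixed multiple of the product of the masses of `U`:
a contradiction. -/

namespace IsContinuousPseudoMetric

variable {X : Type*} [TopologicalSpace X] {d : X → X → ℝ}

lemma nonneg (hd : IsContinuousPseudoMetric d) (x y : X) : 0 ≤ d x y := by
  have h1 := hd.triangle x y x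
  rw [hd.self, hd.symm y x] at h1
  linarith

lemma continuous_of_abs_sub_le (hd : IsContinuousPseudoMetric d) {f : X → ℝ}
    (hf : ∀ x y, |f x - f y| ≤ d x y) : Continuous f := by
  rw [continuous_iff_continuousAt]
  intro x
  have h1 : Tendsto (fun y => d y x) (𝓝 x) (𝓝 0) := by
    have h2 : Continuous fun y => d y x :=
      hd.continuous.comp (continuous_id.prodMk continuous_const)
    simpa [hd.self] using h2.tendsto x
  rw [ContinuousAt, tendsto_iff_dist_tendsto_zero]
  exact squeeze_zero (fun _ => dist_nonneg) (fun y => (Real.dist_eq _ _).trans_le (hf y x)) h1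

/-- The `d`-distance of a point to the nonempty set `K`. -/
noncomputable def distTo (d : X → X → ℝ) (K : Set X) (x : X) : ℝ := ⨅ k : K, d x k

lemma bddBelow_range (hd : IsContinuousPseudoMetric d) (K : Set X) (x : X) :
    BddBelow (Set.range fun k : K => d x k) :=
  ⟨0, by rintro _ ⟨k, rfl⟩; exact hd.nonneg _ _⟩

lemma distTo_nonneg (hd : IsContinuousPseudoMetric d) (K : Set X) (x : X) : 0 ≤ distTo d K x :=
  Real.iInf_nonneg fun _ => hd.nonneg _ _

lemma distTo_eq_zero (hd : IsContinuousPseudoMetric d) {K : Set X} {x : X} (hx : x ∈ K) :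
    distTo d K x = 0 :=
  le_antisymm ((ciInf_le (hd.bddBelow_range K x) ⟨x, hx⟩).trans_eq (hd.self x))
    (hd.distTo_nonneg K x)

lemma abs_distTo_sub_le (hd : IsContinuousPseudoMetric d) {K : Set X} (hK : K.Nonempty)
    (x y : X) : |distTo d K x - distTo d K y| ≤ d x y := by
  have : Nonempty K := hK.to_subtype
  have key : ∀ x y, distTo d K x - distTo d K y ≤ d x y := fun x y => by
    rw [sub_le_comm]
    refine le_ciInf fun k => ?_
    have h1 := ciInf_le (hd.bddBelow_range K x) k
    have h2 := hd.triangle x y k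
    simp only [distTo]
    linarith
  rw [abs_le]
  have h1 := key y x
  rw [hd.symm] at h1
  exact ⟨by linarith, key x y⟩

end IsContinuousPseudoMetric

namespace IsTotallySeparating

variable {X : Type*} [TopologicalSpace X] {d : ℕ → X → X → ℝ}

lemma le_one (hd : IsTotallySeparating d) (n : ℕ) (x y : X) : d n x y ≤ 1 := by
  by_cases h : x = y
  · subst h
    rw [(hd.isContinuousPseudoMetric n).self]
    exact zero_le_one
  · exact (hd.monotone x y).ge_of_tendsto (hd.tendsto_one x y h) n

/-- A totally separating system converges to one uniformly between disjoint compact sets. -/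
lemma eventually_lt_of_isCompact (hd : IsTotallySeparating d) {K L : Set X} (hK : IsCompact K)
    (hL : IsCompact L) (hKL : Disjoint K L) {ε : ℝ} (hε : 0 < ε) :
    ∀ᶠ n in atTop, ∀ x ∈ K, ∀ y ∈ L, 1 - ε < d n x y := by
  -- Dini's theorem on the compact set `K ×ˢ L`, which avoids the diagonal.
  have h := Monotone.tendstoUniformlyOn_of_forall_tendsto (F := fun n (p : X × X) => d n p.1 p.2)
    (f := fun _ => (1 : ℝ)) (hK.prod hL)
    (fun n => (hd.isContinuousPseudoMetric n).continuous.continuousOn)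
    (fun p _ => hd.monotone p.1 p.2) continuousOn_const
    (fun p hp => hd.tendsto_one _ _ (hKL.ne_of_mem hp.1 hp.2))
  filter_upwards [Metric.tendstoUniformlyOn_iff.1 h ε hε] with n hn x hx y hy
  have h1 := hn (x, y) ⟨hx, hy⟩
  rw [Real.dist_eq] at h1
  linarith [(abs_lt.1 h1).2]

end IsTotallySeparating

/-! ### Separating mutually singular measures. -/

section Separation

variable {X : Type*} [TopologicalSpace X] [PolishSpace X] [MeasurableSpace X] [BorelSpace X]

lemma exists_isCompact_subset_measureReal_gt {μ : Measure X} [IsProbabilityMeasure μ] {s : Set X}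
    (hs : MeasurableSet s) (h : μ sᶜ = 0) {ε : ℝ} (hε : 0 < ε) :
    ∃ K ⊆ s, IsCompact K ∧ 1 - ε < μ.real K := by
  have h1 : μ s = 1 := (prob_compl_eq_zero_iff hs).1 h
  obtain ⟨K, hKs, hK, hlt⟩ := hs.exists_lt_isCompact (μ := μ) (r := ENNReal.ofReal (1 - ε)) (by
    rw [h1, ← ENNReal.ofReal_one]
    exact (ENNReal.ofReal_lt_ofReal_iff zero_lt_one).2 (by linarith))
  exact ⟨K, hKs, hK, by
    rw [← ofReal_measureReal] at hlt
    exact ENNReal.ofReal_lt_ofReal_iff'.1 hlt |>.1⟩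

/-- For mutually singular probability measures, the Wasserstein distances induced by a totally
separating system tend to one. -/
lemma IsTotallySeparating.eventually_exists_separating {d : ℕ → X → X → ℝ}
    (hd : IsTotallySeparating d) {μ ν : Measure X} [IsProbabilityMeasure μ]
    [IsProbabilityMeasure ν] (h : μ.MutuallySingular ν) {ε : ℝ} (hε : 0 < ε) (hε1 : ε < 1) :
    ∀ᶠ n in atTop, ∃ φ : X →ᵇ ℝ, (∀ x y, |φ x - φ y| ≤ d n x y) ∧ (∀ x, 0 ≤ φ x) ∧
      (∀ x, φ x ≤ 1) ∧ 1 - 3 * ε ≤ (∫ x, φ x ∂μ) - ∫ x, φ x ∂ν := by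
  obtain ⟨s, hs, hμs, hνs⟩ := h
  obtain ⟨K, hKs, hK, hμK⟩ := exists_isCompact_subset_measureReal_gt (μ := μ) hs.compl
    (by rwa [compl_compl]) hε
  obtain ⟨L, hLs, hL, hνL⟩ := exists_isCompact_subset_measureReal_gt hs hνs hε
  have hLne : L.Nonempty := by
    rw [Set.nonempty_iff_ne_empty]
    rintro rfl
    rw [measureReal_empty] at hνL
    linarith
  have : Nonempty L := hLne.to_subtype
  have hKL : Disjoint K L := (disjoint_compl_left (a := s)).mono hKs hLs
  filter_upwards [hd.eventually_lt_of_isCompact hK hL hKL hε] with n hn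
  have hdn := hd.isContinuousPseudoMetric n
  -- The `d n`-distance to `L` is the test function: it vanishes on `L`, is at least `1 - ε` on `K`,
  -- and never exceeds one.
  set f := IsContinuousPseudoMetric.distTo (d n) L
  have hlip := hdn.abs_distTo_sub_le hLne
  have h0 : ∀ x, 0 ≤ f x := hdn.distTo_nonneg L
  have h1 : ∀ x, f x ≤ 1 := fun x =>
    (ciInf_le (hdn.bddBelow_range L x) (Classical.arbitrary L)).trans (hd.le_one n _ _)
  let φ : X →ᵇ ℝ := BoundedContinuousFunction.ofNormedAddCommGroup f
    (hdn.continuous_of_abs_sub_le hlip) 1 fun x => by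
      rw [Real.norm_eq_abs, abs_of_nonneg (h0 x)]
      exact h1 x
  refine ⟨φ, hlip, h0, h1, ?_⟩
  have hμ : (1 - ε) * (1 - ε) ≤ ∫ x, φ x ∂μ :=
    calc (1 - ε) * (1 - ε) ≤ μ.real K * (1 - ε) := by
          gcongr
      _ = ∫ x, K.indicator (fun _ => 1 - ε) x ∂μ := by
          rw [integral_indicator_const _ hK.measurableSet, smul_eq_mul]
      _ ≤ ∫ x, φ x ∂μ := by
          refine integral_mono ((integrable_const _).indicator hK.measurableSet)
            (φ.integrable μ) fun x => ?_
          by_cases hx : x ∈ K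
          · rw [Set.indicator_of_mem hx]
            exact le_ciInf fun y => (hn x hx y y.2).le
          · rw [Set.indicator_of_notMem hx]
            exact h0 x
  have hν : ∫ x, φ x ∂ν ≤ ε :=
    calc ∫ x, φ x ∂ν ≤ ∫ x, Lᶜ.indicator (fun _ => (1 : ℝ)) x ∂ν := by
          refine integral_mono (φ.integrable ν)
            ((integrable_const _).indicator hL.measurableSet.compl) fun x => ?_
          by_cases hx : x ∈ L
          · rw [Set.indicator_of_notMem (by simpa using hx)]
            exact (hdn.distTo_eq_zero hx).le
          · rw [Set.indicator_of_mem (by simpa using hx)]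
            exact h1 x
      _ = 1 - ν.real L := by
          rw [integral_indicator_const _ hL.measurableSet.compl, smul_eq_mul, mul_one,
            probReal_compl_eq_one_sub hL.measurableSet]
      _ ≤ ε := by linarith
  -- `(1 - ε)² - ε = 1 - 3ε + ε²`.
  nlinarith [sq_nonneg ε]

end Separation

lemma abs_integral_sub_le_of_wassersteinOne_le {X : Type*} [TopologicalSpace X]
    [MeasurableSpace X] {d : X → X → ℝ} {μ ν : Measure X} {c : ℝ} (hc : 0 ≤ c)
    (h : wassersteinOne d μ ν ≤ ENNReal.ofReal c) (φ : X →ᵇ ℝ)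
    (hφ : ∀ x y, |φ x - φ y| ≤ d x y) : |(∫ x, φ x ∂μ) - ∫ x, φ x ∂ν| ≤ c := by
  have key : ∀ ψ : X →ᵇ ℝ, (∀ x y, |ψ x - ψ y| ≤ d x y) →
      (∫ x, ψ x ∂μ) - ∫ x, ψ x ∂ν ≤ c := fun ψ hψ =>
    (ENNReal.ofReal_le_ofReal_iff hc).1 ((le_iSup₂_of_le (f := fun (φ : X →ᵇ ℝ)
      (_ : ∀ x y, |φ x - φ y| ≤ d x y) => ENNReal.ofReal ((∫ x, φ x ∂μ) - ∫ x, φ x ∂ν))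
      ψ hψ le_rfl).trans h)
  have h1 := key φ hφ
  have h2 := key (-φ) fun x y => by
    have h3 := hφ x y
    rw [abs_sub_comm] at h3
    simpa [← sub_eq_neg_add] using h3
  simp only [BoundedContinuousFunction.coe_neg, Pi.neg_apply, integral_neg] at h2
  rw [abs_le]
  constructor <;> linarith

/-- The left side is the average of `ψ x - ψ y` over independent `x ~ μ`, `y ~ ν`; the gain `c`
occurs on `U × U`. Integrating first in `x`, then in `y`, avoids the product measure. -/
lemma integral_sub_integral_le_of_oscillation_le {X : Type*} [MeasurableSpace X]
    {μ ν : Measure X} [IsProbabilityMeasure μ] [IsProbabilityMeasure ν] {ψ : X → ℝ}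
    (hμψ : Integrable ψ μ) (hνψ : Integrable ψ ν) {U : Set X} (hU : MeasurableSet U) {c : ℝ}
    (h1 : ∀ x y, ψ x - ψ y ≤ 1) (hc : ∀ x ∈ U, ∀ y ∈ U, ψ x - ψ y ≤ 1 - c) :
    (∫ x, ψ x ∂μ) - ∫ x, ψ x ∂ν ≤ 1 - c * (μ.real U * ν.real U) := by
  have hint : ∀ (ρ : Measure X) [IsProbabilityMeasure ρ] (a : ℝ),
      Integrable (U.indicator fun _ => a) ρ := fun ρ _ a => (integrable_const a).indicator hU
  have hx : ∀ y, (∫ x, ψ x ∂μ) - ψ y ≤ 1 - U.indicator (fun _ => c * μ.real U) y := fun y => by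
    have h2 : ∫ x, (ψ x - ψ y) ∂μ ≤
        ∫ x, (1 - U.indicator (fun _ => U.indicator (fun _ => c) y) x) ∂μ := by
      refine integral_mono (hμψ.sub (integrable_const _))
        ((integrable_const _).sub (hint μ _)) fun x => ?_
      by_cases hxU : x ∈ U <;> by_cases hyU : y ∈ U <;> simp only [hxU, hyU,
        Set.indicator_of_mem, Set.indicator_of_notMem, not_false_eq_true, sub_zero, h1]
      exact hc x hxU y hyU
    rw [integral_sub hμψ (integrable_const _), integral_sub (integrable_const _) (hint μ _),
      integral_indicator_const _ hU] at h2
    simp only [integral_const, probReal_univ, smul_eq_mul, one_mul] at h2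
    by_cases hyU : y ∈ U
    · simp only [hyU, Set.indicator_of_mem] at h2 ⊢
      linarith
    · simpa [hyU] using h2
  have h3 := integral_mono (μ := ν) ((integrable_const _).sub hνψ)
    ((integrable_const _).sub (hint ν _)) hx
  rw [integral_sub' (integrable_const _) hνψ, integral_sub' (integrable_const _) (hint ν _),
    integral_indicator_const _ hU] at h3
  simp only [integral_const, probReal_univ, smul_eq_mul, one_mul] at h3
  linarith

/-! ### Differences of invariant measures. -/

namespace ProbabilityTheory.Kernel.Invariant

variable {X : Type*} [MeasurableSpace X] {κ : Kernel X X} {μ ν : Measure X}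

lemma integral_integral (h : κ.Invariant μ) {f : X → ℝ}
    (hf : Integrable f μ) : ∫ x, ∫ y, f y ∂κ x ∂μ = ∫ x, f x ∂μ := by
  have h1 : (κ ∘ₖ Kernel.const Unit μ) () = μ := by
    rw [Kernel.comp_apply, Kernel.const_apply]
    exact h
  have h2 := Kernel.integral_comp (η := κ) (κ := Kernel.const Unit μ) (a := ()) (f := f)
    (by rwa [h1])
  rw [h1, Kernel.const_apply] at h2
  exact h2.symm

lemma smul (h : κ.Invariant μ) (c : ℝ≥0∞) : κ.Invariant (c • μ) := by
  rw [Kernel.Invariant, Measure.bind_smul, h.def]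

end ProbabilityTheory.Kernel.Invariant

/-- Subtraction of measures is truncated; as signed measures, `(μ - ν) - (ν - μ)` is the true
difference, and `ν - μ` is nonnegative. -/
lemma MeasureTheory.Measure.le_sub_add_self {X : Type*} [MeasurableSpace X] (μ ν : Measure X)
    [IsFiniteMeasure μ] [IsFiniteMeasure ν] : μ ≤ (μ - ν) + ν := by
  refine Measure.le_intro fun s hs _ => ?_
  have h := congrArg (fun m : SignedMeasure X => m s)
    (Measure.sub_toSignedMeasure_eq_toSignedMeasure_sub (μ := μ) (ν := ν))
  simp only [_root_.sub_apply, Measure.toSignedMeasure_apply_measurable hs] at h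
  rw [← ENNReal.toReal_le_toReal (measure_ne_top _ _) (measure_ne_top _ _), Measure.add_apply,
    ENNReal.toReal_add (measure_ne_top _ _) (measure_ne_top _ _)]
  have h1 : 0 ≤ (ν - μ).real s := measureReal_nonneg
  simp only [Measure.real] at h h1
  linarith

/-- The positive part of the difference of two finite invariant measures is invariant. -/
lemma ProbabilityTheory.Kernel.Invariant.sub {X : Type*} [MeasurableSpace X] {κ : Kernel X X}
    [IsMarkovKernel κ] {μ ν : Measure X} [IsFiniteMeasure μ] [IsFiniteMeasure ν]
    (hμ : κ.Invariant μ) (hν : κ.Invariant ν) : κ.Invariant (μ - ν) := by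
  -- `μ - ν` is the least `ρ` with `μ ≤ ρ + ν`, and pushing this inequality through `κ` shows that
  -- `(μ - ν).bind κ` is another such `ρ`. A Markov kernel preserves total mass, so the two
  -- coincide.
  have hle : μ - ν ≤ (μ - ν).bind κ := by
    refine Measure.sub_le_of_le_add ?_
    refine Measure.le_intro fun s hs _ => ?_
    have h1 : (μ.bind κ) s ≤ ((μ - ν).bind κ) s + (ν.bind κ) s := by
      simp only [Measure.bind_apply hs κ.aemeasurable]
      rw [← lintegral_add_measure]
      exact lintegral_mono' (Measure.le_sub_add_self μ ν) le_rfl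
    rwa [hμ.def, hν.def] at h1
  refine (Measure.eq_of_le_of_measure_univ_eq hle ?_).symm
  rw [Measure.bind_apply .univ κ.aemeasurable]
  simp

namespace MarkovSemigroup

variable {X : Type*} [MeasurableSpace X] {P : MarkovSemigroup X}

/-- Two distinct invariant probability measures give rise to mutually singular ones. -/
lemma exists_mutuallySingular_of_ne {μ ν : Measure X} (hμ : P.IsInvariantProbability μ)
    (hν : P.IsInvariantProbability ν) (hne : μ ≠ ν) :
    ∃ μ' ν' : Measure X, P.IsInvariantProbability μ' ∧ P.IsInvariantProbability ν' ∧
      μ'.MutuallySingular ν' := by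
  have key : ∀ μ ν : Measure X, P.IsInvariantProbability μ → P.IsInvariantProbability ν →
      μ ≠ ν → P.IsInvariantProbability (((μ - ν) Set.univ)⁻¹ • (μ - ν)) := by
    intro μ ν hμ hν hne
    have := hμ.1
    have := hν.1
    have : NeZero (μ - ν) := ⟨fun h0 => hne <| Measure.eq_of_le_of_isProbabilityMeasure <| by
      simpa [h0] using Measure.le_sub_add_self μ ν⟩
    exact ⟨inferInstance, fun t =>
      have := P.isMarkovKernel t
      ((hμ.2 t).sub (hν.2 t)).smul _⟩
  have := hμ.1
  have := hν.1
  exact ⟨_, _, key μ ν hμ hν hne, key ν μ hν hμ hne.symm,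
    (((Measure.mutually_singular_measure_sub (μ := μ) (ν := ν)).smul _).symm.smul _).symm⟩

/-! ### Common support points and the contradiction. -/

variable [TopologicalSpace X] [PolishSpace X] [BorelSpace X]

/-- For a Feller semigroup, an open set charged from a point in the support of an invariant
measure has positive mass under this measure. -/
lemma IsFeller.measure_pos_of_mem_support (hP : P.IsFeller) {μ : Measure X}
    (hμ : P.IsInvariantProbability μ) {u : X} (hu : u ∈ μ.support) {A : Set X} (hA : IsOpen A)
    {t : ℝ≥0} (ht : 0 < P.kernel t u A) : 0 < μ A := by
  have := hμ.1
  have := P.isMarkovKernel t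
  let := TopologicalSpace.upgradeIsCompletelyMetrizable X
  by_contra h0
  have h0 : μ A = 0 := by simpa using h0
  -- Needed because `Metric.infDist` to the empty set is zero by convention, so `φ` below would not
  -- be positive on `A`.
  have hAc : Aᶜ.Nonempty := by
    rw [Set.nonempty_compl]
    rintro rfl
    simp at h0
  let φ : X →ᵇ ℝ := BoundedContinuousFunction.ofNormedAddCommGroup
    (fun x => min 1 (Metric.infDist x Aᶜ))
    (continuous_const.min (Metric.continuous_infDist_pt _)) 1 fun x => by
      rw [Real.norm_eq_abs, abs_of_nonneg (le_min zero_le_one Metric.infDist_nonneg)]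
      exact min_le_left _ _
  have hφ0 : ∀ x, 0 ≤ φ x := fun x => le_min zero_le_one Metric.infDist_nonneg
  have hφpos : ∀ x ∈ A, φ x ≠ 0 := fun x hx => by
    refine (lt_min zero_lt_one ?_).ne'
    exact (hA.isClosed_compl.notMem_iff_infDist_pos hAc).1 (by simpa using hx)
  have hφz : ∀ x ∉ A, φ x = 0 := fun x hx => by
    have : Metric.infDist x Aᶜ = 0 := Metric.infDist_zero_of_mem hx
    change min 1 (Metric.infDist x Aᶜ) = 0
    rw [this, min_eq_right zero_le_one]
  set ψ : X → ℝ := fun x => ∫ y, φ y ∂(P.kernel t x)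
  have hψc : Continuous ψ := hP t φ
  have hψ0 : ∀ x, 0 ≤ ψ x := fun x => integral_nonneg hφ0
  have hint : ∫ x, ψ x ∂μ = 0 := by
    rw [(hμ.2 t).integral_integral (φ.integrable μ)]
    refine integral_eq_zero_of_ae ?_
    filter_upwards [measure_eq_zero_iff_ae_notMem.1 h0] with x hx using hφz x hx
  have hψi : Integrable ψ μ := by
    refine Integrable.of_bound hψc.aestronglyMeasurable ‖φ‖ (ae_of_all _ fun x => ?_)
    simpa using norm_integral_le_of_norm_le_const (μ := P.kernel t x)
      (ae_of_all _ fun y => φ.norm_coe_le_norm y)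
  have hae : ψ =ᵐ[μ] 0 := (integral_eq_zero_iff_of_nonneg hψ0 hψi).1 hint
  -- The zero set of the continuous `ψ` is closed and of full measure, hence contains the support.
  have hψu : ψ u = 0 := Measure.support_subset_of_isClosed (isClosed_eq hψc continuous_const) hae hu
  have hae2 : φ =ᵐ[P.kernel t u] 0 :=
    (integral_eq_zero_iff_of_nonneg hφ0 (φ.integrable _)).1 hψu
  refine ht.ne' (measure_mono_null (fun x hx => ?_) (ae_iff.1 hae2))
  exact hφpos x hx

lemma IsWeaklyTopologicallyIrreducible.exists_mem_support (hIrr : P.IsWeaklyTopologicallyIrreducible)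
    (hP : P.IsFeller) {μ ν : Measure X} (hμ : P.IsInvariantProbability μ)
    (hν : P.IsInvariantProbability ν) : ∃ v, v ∈ μ.support ∧ v ∈ ν.support := by
  have hne : ∀ ρ : Measure X, P.IsInvariantProbability ρ → ∃ u, u ∈ ρ.support := fun ρ hρ => by
    have := hρ.1
    exact Filter.nonempty_of_mem (Measure.support_mem_ae (μ := ρ))
  obtain ⟨u₁, hu₁⟩ := hne μ hμ
  obtain ⟨u₂, hu₂⟩ := hne ν hν
  obtain ⟨v, hv⟩ := hIrr u₁ u₂
  refine ⟨v, ?_, ?_⟩ <;> rw [Measure.support_eq_forall_isOpen] <;> intro A hvA hA <;>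
    obtain ⟨t₁, t₂, -, -, h₁, h₂⟩ := hv A hA hvA
  · exact hP.measure_pos_of_mem_support hμ hu₁ hA h₁
  · exact hP.measure_pos_of_mem_support hν hu₂ hA h₂

/-- Mutually singular invariant probability measures have no common support point at which the
semigroup is asymptotically strong Feller. -/
lemma IsAsymptoticallyStrongFellerAt.not_mutuallySingular {v : X}
    (hv : P.IsAsymptoticallyStrongFellerAt v) (hP : P.IsFeller) {μ ν : Measure X}
    (hμ : P.IsInvariantProbability μ) (hν : P.IsInvariantProbability ν)
    (hvμ : v ∈ μ.support) (hvν : v ∈ ν.support) : ¬ μ.MutuallySingular ν := by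
  intro hsing
  have := hμ.1
  have := hν.1
  obtain ⟨d, t, hd, -, hinf⟩ := hv
  -- Comparing two points of `U` through `v` doubles 1/8, so the oscillation on `U` is at most 1/4,
  -- that is `c = 3 / 4` below.
  have hlt : (⨅ (U : Set X) (_ : IsOpen U ∧ v ∈ U),
      limsup (fun n => ⨆ y ∈ U, wassersteinOne (d n) (P.kernel (t n) v) (P.kernel (t n) y)) atTop)
        < ENNReal.ofReal (1 / 8) := by
    rw [hinf]
    exact ENNReal.ofReal_pos.2 (by norm_num)
  simp only [iInf_lt_iff] at hlt
  obtain ⟨U, ⟨hU, hvU⟩, hlim⟩ := hlt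
  rw [Measure.support_eq_forall_isOpen] at hvμ hvν
  have hposμ : 0 < μ.real U := ENNReal.toReal_pos (hvμ U hvU hU).ne' (measure_ne_top _ _)
  have hposν : 0 < ν.real U := ENNReal.toReal_pos (hvν U hvU hU).ne' (measure_ne_top _ _)
  have hpos : 0 < μ.real U * ν.real U := mul_pos hposμ hposν
  have hle : μ.real U * ν.real U ≤ 1 :=
    mul_le_one₀ measureReal_le_one measureReal_nonneg measureReal_le_one
  -- With `m` the product of the two masses of `U`, `ε = m / 5` gives separation at least `1 -
  -- 3m/5`, which exceeds the upper bound `1 - 3m/4` obtained from the oscillation.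
  obtain ⟨n, ⟨φ, hlip, h0, h1, hsep⟩, hn⟩ :=
    ((hd.eventually_exists_separating hsing (ε := μ.real U * ν.real U / 5) (by positivity)
      (by linarith)).and (eventually_lt_of_limsup_lt hlim)).exists
  have := P.isMarkovKernel (t n)
  set ψ : X → ℝ := fun x => ∫ y, φ y ∂(P.kernel (t n) x)
  have hψ0 : ∀ x, 0 ≤ ψ x := fun x => integral_nonneg h0
  have hψ1 : ∀ x, ψ x ≤ 1 := fun x => by
    simpa using integral_mono (φ.integrable (P.kernel (t n) x)) (integrable_const 1) h1
  have hψU : ∀ y ∈ U, |ψ v - ψ y| ≤ 1 / 8 := fun y hy =>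
    abs_integral_sub_le_of_wassersteinOne_le (by norm_num)
      ((le_iSup₂_of_le (f := fun y (_ : y ∈ U) =>
        wassersteinOne (d n) (P.kernel (t n) v) (P.kernel (t n) y)) y hy le_rfl).trans hn.le) φ hlip
  have hψi : ∀ ρ : Measure X, IsProbabilityMeasure ρ → Integrable ψ ρ := fun ρ _ =>
    Integrable.of_bound (hP (t n) φ).aestronglyMeasurable 1 <| ae_of_all _ fun x => by
      rw [Real.norm_eq_abs, abs_of_nonneg (hψ0 x)]
      exact hψ1 x
  have hbound := integral_sub_integral_le_of_oscillation_le (hψi μ hμ.1) (hψi ν hν.1)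
    hU.measurableSet (c := 3 / 4) (fun x y => by linarith [hψ0 y, hψ1 x])
    (fun x hx y hy => by
      have h2 := abs_le.1 (hψU x hx)
      have h3 := abs_le.1 (hψU y hy)
      linarith [h2.1, h3.2])
  rw [(hμ.2 (t n)).integral_integral (φ.integrable μ),
    (hν.2 (t n)).integral_integral (φ.integrable ν)] at hbound
  linarith

end MarkovSemigroup

theorem mainTheorem9 {X : Type*} [TopologicalSpace X] [PolishSpace X] [MeasurableSpace X]
    [BorelSpace X] (P : MarkovSemigroup X) (hFeller : P.IsFeller)
    (hIrr : P.IsWeaklyTopologicallyIrreducible) (hASF : P.IsAsymptoticallyStrongFeller)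
    (μ ν : Measure X) (hμ : P.IsInvariantProbability μ) (hν : P.IsInvariantProbability ν) :
    μ = ν := by
  by_contra hne
  obtain ⟨μ', ν', hμ', hν', hsing⟩ := MarkovSemigroup.exists_mutuallySingular_of_ne hμ hν hne
  obtain ⟨v, hvμ, hvν⟩ := hIrr.exists_mem_support hFeller hμ' hν'
  exact (hASF v).not_mutuallySingular hFeller hμ' hν' hvμ hvν hsing
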